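/- All digraphs are finite, may have multiple edges and loops, and come with a fixed embedding in the sphere $S^2$; two of them are regarded as the same if an orientation-preserving homeomorphism of $S^2$ carries one to the other, respecting the directions of the edges. A digraph is *prime* if it has no loop, no cut vertex, and there is no simple closed curve in $S^2$ that is disjoint from the vertices, meets the edges in exactly two points, and has at least one vertex on each side. Let $\Gamma$ be the set of connected (non-empty), planar, prime digraphs such that, at every vertex, incoming and outgoing edges alternate in the cyclic order around the vertex. For a vertex $v$ of $\mathcal{G}$ let $\mathrm{Tr}(\mathcal{G},v)$ be the set of directed spanning subtrees of $\mathcal{G}$ with origin $v$, that is, spanning connected subgraphs without simple closed curves in which every vertex is the terminal vertex of at most one edge and $v$ is the terminal vertex of none. Define four digraphs embedded in $S^2$. * $\mathcal{G}_\alpha$ is a single vertex with no edges. * $\mathcal{G}_\beta$ has two vertices joined by four parallel edges, drawn side by side and directed alternately from the first vertex to the second and from the second to the first. * $\mathcal{G}_\gamma$ is the same with six edges instead of four. * $\mathcal{G}_\delta$ has three vertices at the corners of a triangle and six edges; each side of the triangle is a pair of oppositely directed parallel edges, the three outer edges forming a clockwise directed triangle and the three inner edges a counterclockwise directed triangle.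 **Theorem.** Let $\mathcal{G}\in\Gamma$, and suppose that $|\mathrm{Tr}(\mathcal{G},v)|<4$ for some vertex $v$ of $\mathcal{G}$ (in particular, this covers the case that $|\mathrm{Tr}(\mathcal{G},v)|<4$ for every vertex $v$). Then $\mathcal{G}$ is, up to reflection (that is, $\mathcal{G}$ or its mirror image is), one of the digraphs $\mathcal{G}_\alpha,\mathcal{G}_\beta,\mathcal{G}_\gamma,\mathcal{G}_\delta$. -/

import Mathlib

/-- A digraph (loops and multiple edges allowed) with vertices `V` and edges `E`, together with an
embedding in an oriented closed surface all of whose regions are discs, recorded as usual by its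
rotation system. The edge `e` has two ends: `(e, true)` is the end at its initial vertex `src e`,
and `(e, false)` is the end at its terminal vertex `tgt e`. The permutation `rot` sends an end to the
next one counterclockwise around the same vertex, so the ends at each vertex form one cycle
of `rot` (none at an isolated vertex). -/
structure EmbDigraph (V : Type*) (E : Type*) where
  /-- initial vertex -/
  src : E → V
  /-- terminal vertex -/
  tgt : E → V
  /-- the next end, counterclockwise around the vertex -/
  rot : Equiv.Perm (E × Bool)
  rot_vertex : ∀ d : E × Bool,
    (if (rot d).2 then src (rot d).1 else tgt (rot d).1) = (if d.2 then src d.1 else tgt d.1)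
  rot_cycle : ∀ d d' : E × Bool,
    (if d.2 then src d.1 else tgt d.1) = (if d'.2 then src d'.1 else tgt d'.1) → rot.SameCycle d d'

namespace EmbDigraph

variable {V : Type*} {E : Type*} {V' : Type*} {E' : Type*}

/-- The vertex at an end of an edge. -/
def endVertex (G : EmbDigraph V E) (d : E × Bool) : V :=
  if d.2 then G.src d.1 else G.tgt d.1

/-- The opposite end of the same edge. -/
def flipEnd : Equiv.Perm (E × Bool) where
  toFun d := (d.1, !d.2)
  invFun d := (d.1, !d.2)
  left_inv d := by simp
  right_inv d := by simp

/-! ### Regions -/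

/-- Walk along an edge starting from the end `d`, and at the other vertex take the next edge
clockwise. This follows the boundary of the region on the left. -/
def faceNext (G : EmbDigraph V E) : Equiv.Perm (E × Bool) :=
  flipEnd.trans G.rot.symm

/-- Regions of the complement, for a digraph with at least one edge: the cycles of `faceNext`. -/
def Face (G : EmbDigraph V E) : Type _ :=
  Quotient (Equiv.Perm.SameCycle.setoid G.faceNext)

/-- The region on the left of an edge walked from its end `d`. -/
def faceOf (G : EmbDigraph V E) (d : E × Bool) : G.Face :=
  Quotient.mk (Equiv.Perm.SameCycle.setoid G.faceNext) d

/-- The region on the left of the directed edge `e`. -/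
def leftFace (G : EmbDigraph V E) (e : E) : G.Face := G.faceOf (e, true)

/-- The region on the right of the directed edge `e`. -/
def rightFace (G : EmbDigraph V E) (e : E) : G.Face := G.faceOf (e, false)

open Classical in
/-- The number of regions of the complement of a connected embedded digraph. The complement of a
single vertex without edges is one region. -/
noncomputable def numFaces (G : EmbDigraph V E) : ℕ :=
  if Nonempty E then Nat.card G.Face else 1

/-! ### Connectedness -/

/-- `a` and `b` are joined by an (undirected) path all of whose vertices are in `S` and all of whose
edges are in `T`, where `a = b` is allowed. -/
def Joined (G : EmbDigraph V E) (S : Set V) (T : Set E) (a b : V) : Prop :=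
  Relation.EqvGen
    (fun x y => ∃ e ∈ T, G.src e = x ∧ G.tgt e = y ∧ x ∈ S ∧ y ∈ S) a b

/-- The digraph is connected (ignoring directions), and non-empty. -/
def Connected (G : EmbDigraph V E) : Prop :=
  Nonempty V ∧ ∀ a b : V, G.Joined Set.univ Set.univ a b

/-- A connected embedded digraph lies in the sphere: Euler's formula `|V| - |E| + |F| = 2`. -/
def Planar (G : EmbDigraph V E) : Prop :=
  Nat.card V + G.numFaces = Nat.card E + 2

/-- The subgraph induced on the vertices other than `v` is disconnected. -/
def IsCutVertex (G : EmbDigraph V E) (v : V) : Prop :=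
  ∃ a b : V, a ≠ v ∧ b ≠ v ∧ ¬ G.Joined {x | x ≠ v} Set.univ a b

/-! ### Primeness and the class `Γ` -/

/-- A simple closed curve in the sphere, disjoint from the vertices, which meets the edges in exactly
two points, one on `e` and one on `f`, and has the vertices of `A` on one side and all others on
the other side, each side having at least one vertex. The curve runs through one region from one side
of `e` to a side of `f`, and back through a region from the other side of `f` to the other side
of `e`; the edges it meets are those that join `A` to its complement. -/
def TwoPointCurve (G : EmbDigraph V E) (A : Set V) (e f : E) : Prop :=
  e ≠ f ∧ A.Nonempty ∧ Aᶜ.Nonempty ∧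
  ((G.leftFace e = G.leftFace f ∧ G.rightFace e = G.rightFace f) ∨
    (G.leftFace e = G.rightFace f ∧ G.rightFace e = G.leftFace f)) ∧
  ∀ g : E, (g = e ∨ g = f) ↔ ¬ (G.src g ∈ A ↔ G.tgt g ∈ A)

/-- A planar digraph is prime if it has no loop, no cut vertex, and no simple closed curve that
misses the vertices, meets the edges in exactly two points and separates the vertices. -/
def Prime (G : EmbDigraph V E) : Prop :=
  (∀ e : E, G.src e ≠ G.tgt e) ∧
  (∀ v : V, ¬ G.IsCutVertex v) ∧
  ¬ ∃ (A : Set V) (e f : E), G.TwoPointCurve A e f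

/-- Incoming and outgoing edges alternate around every vertex. -/
def Alternating (G : EmbDigraph V E) : Prop :=
  ∀ d : E × Bool, (G.rot d).2 ≠ d.2

/-- The class `Γ` of connected, planar, prime digraphs in which incoming and outgoing edges alternate
at every vertex. -/
structure InGamma (G : EmbDigraph V E) : Prop where
  connected : G.Connected
  planar : G.Planar
  prime : G.Prime
  alternating : G.Alternating

/-! ### Directed spanning subtrees -/

/-- The edges `T` contain a simple closed curve: edges `c 0, …, c n` walked cyclically in either
direction, with distinct edges and distinct vertices (a loop if `n = 0`). -/
def HasCycle (G : EmbDigraph V E) (T : Set E) : Prop :=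
  ∃ (n : ℕ) (c : Fin (n + 1) → E × Bool),
    (∀ i, (c i).1 ∈ T) ∧
    (∀ i, G.endVertex (flipEnd (c i)) = G.endVertex (c (i + 1))) ∧
    Function.Injective (fun i => (c i).1) ∧
    Function.Injective (fun i => G.endVertex (c i))

/-- The subgraph with all vertices and edge set `T` is a directed tree with origin `v`: it is
connected, contains no simple closed curve, every vertex is the terminal vertex of at most one of
its edges, and `v` is the terminal vertex of none. -/
structure IsSpanningTree (G : EmbDigraph V E) (v : V) (T : Set E) : Prop where
  connected : ∀ a b : V, G.Joined Set.univ T a b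
  acyclic : ¬ G.HasCycle T
  unique_in : ∀ e ∈ T, ∀ f ∈ T, G.tgt e = G.tgt f → e = f
  origin : ∀ e ∈ T, G.tgt e ≠ v

/-- The set of directed spanning subtrees with origin `v`, each given by its edge set. -/
def Tr (G : EmbDigraph V E) (v : V) : Set (Set E) :=
  {T | G.IsSpanningTree v T}

/-! ### Isomorphism and reflection -/

/-- Isomorphism of embedded digraphs, preserving directions and the counterclockwise order of the edge
ends at every vertex: an orientation-preserving homeomorphism of the surfaces that carries
one digraph to the other. -/
structure Iso (G : EmbDigraph V E) (H : EmbDigraph V' E') where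
  /-- on vertices -/
  onV : V ≃ V'
  /-- on edges -/
  onE : E ≃ E'
  map_src : ∀ e, H.src (onE e) = onV (G.src e)
  map_tgt : ∀ e, H.tgt (onE e) = onV (G.tgt e)
  map_rot : ∀ d : E × Bool, H.rot (onE d.1, d.2) = (onE (G.rot d).1, (G.rot d).2)

/-- The mirror image: the same digraph with the opposite cyclic order around every vertex. -/
def reflect (G : EmbDigraph V E) : EmbDigraph V E where
  src := G.src
  tgt := G.tgt
  rot := G.rot⁻¹
  rot_vertex d := by simpa using (G.rot_vertex (G.rot⁻¹ d)).symm
  rot_cycle d d' h := (G.rot_cycle d d' h).inv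

/-- `G` is, up to reflection, the embedded digraph `H`. -/
def IsoUpToReflection (G : EmbDigraph V E) (H : EmbDigraph V' E') : Prop :=
  Nonempty (Iso G H) ∨ Nonempty (Iso G H.reflect)

/-! ### The four digraphs -/

/-- `G_α`: a single vertex and no edges. -/
def Gα : EmbDigraph (Fin 1) (Fin 0) where
  src := Fin.elim0
  tgt := Fin.elim0
  rot := 1
  rot_vertex d := d.1.elim0
  rot_cycle d := d.1.elim0

/-- Edges `0, 1, …` drawn side by side from a vertex `0` to a vertex `1`; those with even number are
directed from `0` to `1`, the others from `1` to `0`. -/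
def dipoleSrc {n : ℕ} (e : Fin n) : Fin 2 := if e.val % 2 = 0 then 0 else 1

/-- Terminal vertices of these edges. -/
def dipoleTgt {n : ℕ} (e : Fin n) : Fin 2 := if e.val % 2 = 0 then 1 else 0

/-- The order of the ends: edges with increasing numbers around the vertex `0`, and with decreasing
numbers around the vertex `1`. -/
def dipoleNext {n : ℕ} [NeZero n] (d : Fin n × Bool) : Fin n × Bool :=
  if (if d.2 then dipoleSrc d.1 else dipoleTgt d.1) = 0 then (d.1 + 1, !d.2) else (d.1 - 1, !d.2)

/-- The inverse of `dipoleNext`, for an even number of edges. -/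
def dipolePrev {n : ℕ} [NeZero n] (d : Fin n × Bool) : Fin n × Bool :=
  if (if d.2 then dipoleSrc d.1 else dipoleTgt d.1) = 0 then (d.1 - 1, !d.2) else (d.1 + 1, !d.2)

/-- `G_β`: two vertices and four edges, alternately directed. -/
def Gβ : EmbDigraph (Fin 2) (Fin 4) where
  src := dipoleSrc
  tgt := dipoleTgt
  rot := ⟨dipoleNext, dipolePrev, by decide, by decide⟩
  rot_vertex := by decide
  rot_cycle := by
    suffices h : ∀ d d' : Fin 4 × Bool,
        (if d.2 then dipoleSrc d.1 else dipoleTgt d.1) =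
          (if d'.2 then dipoleSrc d'.1 else dipoleTgt d'.1) →
        ∃ k : Fin 4, dipoleNext^[k.val] d = d' by
      intro d d' hd
      obtain ⟨k, hk⟩ := h d d' hd
      refine ⟨(k.val : ℤ), ?_⟩
      rw [zpow_natCast, ← Equiv.Perm.iterate_eq_pow]
      exact hk
    decide

/-- `G_γ`: two vertices and six edges, alternately directed. -/
def Gγ : EmbDigraph (Fin 2) (Fin 6) where
  src := dipoleSrc
  tgt := dipoleTgt
  rot := ⟨dipoleNext, dipolePrev, by decide, by decide⟩
  rot_vertex := by decide
  rot_cycle := by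
    suffices h : ∀ d d' : Fin 6 × Bool,
        (if d.2 then dipoleSrc d.1 else dipoleTgt d.1) =
          (if d'.2 then dipoleSrc d'.1 else dipoleTgt d'.1) →
        ∃ k : Fin 6, dipoleNext^[k.val] d = d' by
      intro d d' hd
      obtain ⟨k, hk⟩ := h d d' hd
      refine ⟨(k.val : ℤ), ?_⟩
      rw [zpow_natCast, ← Equiv.Perm.iterate_eq_pow]
      exact hk
    decide

/-- The outer edge `(i, true)` runs from `i` to `i + 1`, the inner edge `(i, false)` from `i + 1`
to `i`, for `i` modulo 3. -/
def deltaSrc (e : Fin 3 × Bool) : Fin 3 := if e.2 then e.1 else e.1 + 1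

/-- Terminal vertices of these edges. -/
def deltaTgt (e : Fin 3 × Bool) : Fin 3 := if e.2 then e.1 + 1 else e.1

/-- The vertices `0, 1, 2` are placed clockwise around a triangle. Counterclockwise around the
vertex `i` one meets the end of the outer edge from `i - 1`, the start of the inner edge to `i - 1`,
the end of the inner edge from `i + 1` and the start of the outer edge to `i + 1`. -/
def deltaNext : (Fin 3 × Bool) × Bool → (Fin 3 × Bool) × Bool
  | ((i, true), false) => ((i, false), true)
  | ((i, false), true) => ((i + 1, false), false)
  | ((i, false), false) => ((i, true), true)
  | ((i, true), true) => ((i - 1, true), false)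

/-- The inverse of `deltaNext`. -/
def deltaPrev : (Fin 3 × Bool) × Bool → (Fin 3 × Bool) × Bool
  | ((i, false), true) => ((i, true), false)
  | ((i, false), false) => ((i - 1, false), true)
  | ((i, true), true) => ((i, false), false)
  | ((i, true), false) => ((i + 1, true), true)

/-- `G_δ`: a triangle in which each side is a pair of oppositely directed edges; the outer edges form a
clockwise directed triangle and the inner edges a counterclockwise one. -/
def Gδ : EmbDigraph (Fin 3) (Fin 3 × Bool) where
  src := deltaSrc
  tgt := deltaTgt
  rot := ⟨deltaNext, deltaPrev, by decide, by decide⟩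
  rot_vertex := by decide
  rot_cycle := by
    suffices h : ∀ d d' : (Fin 3 × Bool) × Bool,
        (if d.2 then deltaSrc d.1 else deltaTgt d.1) =
          (if d'.2 then deltaSrc d'.1 else deltaTgt d'.1) →
        ∃ k : Fin 4, deltaNext^[k.val] d = d' by
      intro d d' hd
      obtain ⟨k, hk⟩ := h d d' hd
      refine ⟨(k.val : ℤ), ?_⟩
      rw [zpow_natCast, ← Equiv.Perm.iterate_eq_pow]
      exact hk
    decide

end EmbDigraph

/-!
Let `G` be a digraph of the class `Γ`. Since incoming and outgoing edges alternate, as many edges leave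
a set `A` of vertices as enter it, and the boundary of every region is a directed closed walk.
If only one edge leaves `A`, hence only one enters it, then a region touching one of these
edges has to touch the other, and primeness fails. So at least two edges leave every proper
non-empty set of vertices (`InGamma.two_le_ncard_leaving`).

By Edmonds' theorem, two edge-disjoint spanning branchings start from every vertex `v`. What is
needed of it is `exists_branching_univ`: a spanning branching `T` whose complement still reaches
every vertex. Grow a branching `U` in the complement of `T`, one vertex at a time; at each
stage, `U` together with the edges of `T` into the vertices not yet reached is a directed spanning
tree with origin `v`. These trees have `0, 1, 2, …` edges outside `T`, so there are at least as
many of them as vertices (`card_le_ncard_tr`), and fewer than four trees leave at most three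
vertices.

* One vertex: there are no edges, because there are no loops.
* Two vertices: every edge starting from `v` is a tree, so `v` has two or three outgoing edges. By
  Euler's formula there are as many regions as edges, so all regions have length two
  (`faceNext_faceNext`), and this determines the embedding (`nonempty_iso_dipole`).
* Three vertices: the number of trees is a quadratic polynomial in the numbers of edges between the
  vertices, which forces exactly one edge from each vertex to each other
  (`ncard_edgesBetween_eq_one`). Alternation leaves two rotations at each vertex, those of `Gδ` and
  of its mirror image. By Euler's formula there are five regions, but there are at most three if
  the two kinds of rotation are mixed (`exists_iterate_mixedPrev`).
-/

namespace EmbDigraph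

variable {V E V' E' : Type*}

/-! ### Edge cuts -/

theorem faceNext_apply (G : EmbDigraph V E) (d : E × Bool) :
    G.faceNext d = G.rot.symm (flipEnd d) := rfl

theorem flipEnd_flipEnd (d : E × Bool) : flipEnd (flipEnd d) = d :=
  flipEnd.left_inv d

theorem endVertex_rot (G : EmbDigraph V E) (d : E × Bool) :
    G.endVertex (G.rot d) = G.endVertex d := G.rot_vertex d

theorem endVertex_rot_symm (G : EmbDigraph V E) (d : E × Bool) :
    G.endVertex (G.rot.symm d) = G.endVertex d := by
  simpa using (G.endVertex_rot (G.rot.symm d)).symm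

theorem Alternating.rot_snd {G : EmbDigraph V E} (h : G.Alternating) (d : E × Bool) :
    (G.rot d).2 = !d.2 := by
  have := h d
  cases h1 : (G.rot d).2 <;> cases h2 : d.2 <;> simp_all

theorem Alternating.rot_symm_snd {G : EmbDigraph V E} (h : G.Alternating) (d : E × Bool) :
    (G.rot.symm d).2 = !d.2 := by
  have := h.rot_snd (G.rot.symm d)
  simp at this
  simp [this]

theorem Alternating.faceNext_snd {G : EmbDigraph V E} (h : G.Alternating) (d : E × Bool) :
    (G.faceNext d).2 = d.2 := by
  rw [faceNext_apply, h.rot_symm_snd]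
  simp [flipEnd]

theorem endVertex_faceNext (G : EmbDigraph V E) (d : E × Bool) :
    G.endVertex (G.faceNext d) = G.endVertex (flipEnd d) := by
  rw [faceNext_apply, endVertex_rot_symm]

theorem faceOf_eq_iff (G : EmbDigraph V E) (d d' : E × Bool) :
    G.faceOf d = G.faceOf d' ↔ G.faceNext.SameCycle d d' :=
  Quotient.eq (r := Equiv.Perm.SameCycle.setoid G.faceNext)

/-- A walk around a region that leaves `A` has to come back into `A`. -/
theorem exists_faceOf_eq_of_leaving [Finite E] (G : EmbDigraph V E) (A : Set V) (d : E × Bool)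
    (h1 : G.endVertex d ∈ A) (h2 : G.endVertex (flipEnd d) ∉ A) :
    ∃ d', G.faceOf d = G.faceOf d' ∧ G.endVertex d' ∉ A ∧ G.endVertex (flipEnd d') ∈ A := by
  by_contra! hno
  have key : ∀ k : ℕ, G.endVertex (flipEnd ((G.faceNext ^ k) d)) ∉ A := by
    intro k
    induction k with
    | zero => simpa using h2
    | succ k ih =>
      refine hno _ ((G.faceOf_eq_iff _ _).2 ⟨(k + 1 : ℕ), by rw [zpow_natCast]⟩) ?_
      rw [pow_succ', Equiv.Perm.mul_apply, endVertex_faceNext]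
      exact ih
  obtain ⟨k, hk⟩ : ∃ k, orderOf G.faceNext = k + 1 :=
    Nat.exists_eq_succ_of_ne_zero (orderOf_pos _).ne'
  have h := key k
  rw [← endVertex_faceNext, ← Equiv.Perm.mul_apply, ← pow_succ', ← hk, pow_orderOf_eq_one] at h
  exact h h1

/-- In an alternating digraph as many edges start in `A` as end in `A`. -/
theorem Alternating.ncard_src_eq_ncard_tgt {G : EmbDigraph V E} (h : G.Alternating) (A : Set V) :
    {e | G.src e ∈ A}.ncard = {e | G.tgt e ∈ A}.ncard := by
  have himg : ∀ b : Bool, (fun e : E => (e, b)) '' {e | G.endVertex (e, b) ∈ A} =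
      {d | d.2 = b ∧ G.endVertex d ∈ A} := by
    intro b
    ext ⟨e, b'⟩
    simp only [Set.mem_image, Set.mem_ofPred_eq, Prod.mk.injEq]
    constructor
    · rintro ⟨_, h, rfl, rfl⟩; exact ⟨rfl, h⟩
    · rintro ⟨rfl, h⟩; exact ⟨e, h, rfl, rfl⟩
  have hinj : ∀ b : Bool, Function.Injective (fun e : E => (e, b)) :=
    fun b e e' h => (Prod.mk.inj h).1
  have hrot : G.rot '' {d | d.2 = true ∧ G.endVertex d ∈ A} =
      {d | d.2 = false ∧ G.endVertex d ∈ A} := by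
    ext d
    simp only [Set.mem_image, Set.mem_ofPred_eq]
    constructor
    · rintro ⟨d, ⟨h1, h2⟩, rfl⟩
      rw [h.rot_snd, endVertex_rot, h1]; exact ⟨rfl, h2⟩
    · rintro ⟨h1, h2⟩
      refine ⟨G.rot.symm d, ⟨?_, ?_⟩, by simp⟩
      · rw [h.rot_symm_snd, h1]; rfl
      · rwa [endVertex_rot_symm]
  have h1 := Set.ncard_image_of_injective {e | G.endVertex (e, true) ∈ A} (hinj true)
  have h2 := Set.ncard_image_of_injective {e | G.endVertex (e, false) ∈ A} (hinj false)
  have h3 := Set.ncard_image_of_injective {d | d.2 = true ∧ G.endVertex d ∈ A} G.rot.injective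
  rw [himg] at h1 h2
  rw [hrot] at h3
  have e1 : {e | G.src e ∈ A} = {e | G.endVertex (e, true) ∈ A} := by simp [endVertex]
  have e2 : {e | G.tgt e ∈ A} = {e | G.endVertex (e, false) ∈ A} := by simp [endVertex]
  rw [e1, e2, ← h1, ← h2, h3]

/-- The edges from `A` to its complement. -/
def leaving (G : EmbDigraph V E) (A : Set V) : Set E := {e | G.src e ∈ A ∧ G.tgt e ∉ A}

theorem Alternating.ncard_leaving_compl [Finite E] {G : EmbDigraph V E} (h : G.Alternating)
    (A : Set V) : (G.leaving Aᶜ).ncard = (G.leaving A).ncard := by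
  have h0 := h.ncard_src_eq_ncard_tgt A
  have h1 := Set.ncard_sdiff_add_ncard_of_subset
    (s := {e | G.src e ∈ A ∧ G.tgt e ∈ A}) (t := {e | G.src e ∈ A}) (fun e he => he.1)
  have h2 := Set.ncard_sdiff_add_ncard_of_subset
    (s := {e | G.src e ∈ A ∧ G.tgt e ∈ A}) (t := {e | G.tgt e ∈ A}) (fun e he => he.2)
  have e1 : {e | G.src e ∈ A} \ {e | G.src e ∈ A ∧ G.tgt e ∈ A} = G.leaving A := by
    ext e; simp [leaving]; tauto
  have e2 : {e | G.tgt e ∈ A} \ {e | G.src e ∈ A ∧ G.tgt e ∈ A} = G.leaving Aᶜ := by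
    ext e; simp [leaving]; tauto
  rw [e1] at h1
  rw [e2] at h2
  omega

theorem Joined.mem_of_cut_empty {G : EmbDigraph V E} {S : Set V} {T : Set E} {A : Set V}
    (hA : ∀ e, G.src e ∈ A ↔ G.tgt e ∈ A) {a b : V} (h : G.Joined S T a b) : a ∈ A ↔ b ∈ A := by
  induction h with
  | rel x y h => obtain ⟨e, -, rfl, rfl, -⟩ := h; exact hA e
  | refl => rfl
  | symm _ _ _ ih => exact ih.symm
  | trans _ _ _ _ _ ih1 ih2 => exact ih1.trans ih2

/-- In a digraph of the class `Γ` at least two edges leave every proper non-empty set `A` of vertices.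
Some edge joins `A` to its complement, and as many edges leave `A` as enter it. If there
is only one of each, then each region that touches the one touches the other as well, and
the curve forbidden by primeness exists. -/
theorem InGamma.two_le_ncard_leaving [Finite E] {G : EmbDigraph V E} (hG : G.InGamma) {A : Set V}
    (hA : A.Nonempty) (hA' : Aᶜ.Nonempty) : 2 ≤ (G.leaving A).ncard := by
  have hbal := hG.alternating.ncard_leaving_compl A
  by_contra! hlt
  have hcases : (G.leaving A).ncard = 0 ∨ (G.leaving A).ncard = 1 := by omega
  rcases hcases with h0 | h1
  · have h0' : (G.leaving Aᶜ).ncard = 0 := by omega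
    rw [Set.ncard_eq_zero] at h0 h0'
    obtain ⟨a, ha⟩ := hA
    obtain ⟨b, hb⟩ := hA'
    have hcut : ∀ e, G.src e ∈ A ↔ G.tgt e ∈ A := by
      intro e
      have h1 : e ∉ G.leaving A := by simp [h0]
      have h2 : e ∉ G.leaving Aᶜ := by simp [h0']
      simp only [leaving, Set.mem_ofPred_eq, Set.mem_compl_iff] at h1 h2
      tauto
    exact hb ((Joined.mem_of_cut_empty hcut (hG.connected.2 a b)).1 ha)
  · have h1' : (G.leaving Aᶜ).ncard = 1 := by omega
    obtain ⟨e, he⟩ := Set.ncard_eq_one.1 h1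
    obtain ⟨f, hf⟩ := Set.ncard_eq_one.1 h1'
    have he' : G.src e ∈ A ∧ G.tgt e ∉ A := by
      have : e ∈ G.leaving A := by simp [he]
      exact this
    have hf' : G.src f ∉ A ∧ G.tgt f ∈ A := by
      have : f ∈ G.leaving Aᶜ := by simp [hf]
      simpa [leaving] using this
    have hfu : ∀ g, G.src g ∉ A → G.tgt g ∈ A → g = f := by
      intro g h1 h2
      have : g ∈ G.leaving Aᶜ := by simp [leaving, h1, h2]
      simpa [hf] using this
    have heu : ∀ g, G.src g ∈ A → G.tgt g ∉ A → g = e := by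
      intro g h1 h2
      have : g ∈ G.leaving A := ⟨h1, h2⟩
      simpa [he] using this
    have hsnd : ∀ d d', G.faceOf d = G.faceOf d' → d'.2 = d.2 := by
      intro d d' h
      obtain ⟨i, rfl⟩ := ((G.faceOf_eq_iff d d').1 h).exists_nat_pow_eq
      clear h
      induction i with
      | zero => rfl
      | succ i ih => rw [pow_succ', Equiv.Perm.mul_apply, hG.alternating.faceNext_snd, ih]
    refine hG.prime.2.2 ⟨A, e, f, ?_, hA, hA', Or.inl ⟨?_, ?_⟩, ?_⟩
    · rintro rfl; exact hf'.1 he'.1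
    · obtain ⟨⟨g, b⟩, hd, h3, h4⟩ := G.exists_faceOf_eq_of_leaving A (e, true) he'.1 he'.2
      obtain rfl : b = true := hsnd _ _ hd
      rw [hfu g h3 h4] at hd
      exact hd
    · obtain ⟨⟨g, b⟩, hd, h3, h4⟩ := G.exists_faceOf_eq_of_leaving Aᶜ (e, false) he'.2
        (fun h => h he'.1)
      obtain rfl : b = false := hsnd _ _ hd
      rw [hfu g h4 (not_not.1 h3)] at hd
      exact hd
    · intro g
      constructor
      · rintro (rfl | rfl) <;> tauto
      · intro h
        by_cases hs : G.src g ∈ A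
        · exact Or.inl (heu g hs (by tauto))
        · exact Or.inr (hfu g hs (by tauto))

/-! ### Directed spanning trees -/

/-- A set of edges, exactly one into each vertex other than `v` and none into `v`, is a directed
spanning tree as soon as some rank function increases along its edges: going backwards from
any vertex one has to end at `v`, and a cycle would enter its vertex of largest rank twice. -/
theorem isSpanningTree_of_rank {G : EmbDigraph V E} {v : V} {T : Set E} (r : V → ℕ)
    (hr : ∀ e ∈ T, r (G.src e) < r (G.tgt e)) (hin : ∀ x, x ≠ v → ∃ e ∈ T, G.tgt e = x)
    (huniq : ∀ e ∈ T, ∀ f ∈ T, G.tgt e = G.tgt f → e = f) (horig : ∀ e ∈ T, G.tgt e ≠ v) :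
    G.IsSpanningTree v T where
  connected := by
    have hv : ∀ n x, r x = n → G.Joined Set.univ T v x := by
      intro n
      induction n using Nat.strong_induction_on with
      | _ n ih =>
        rintro x rfl
        by_cases hx : x = v
        · subst hx; exact Relation.EqvGen.refl _
        · obtain ⟨e, he, rfl⟩ := hin x hx
          exact (ih _ (hr e he) _ rfl).trans _ _ _
            (Relation.EqvGen.rel _ _ ⟨e, he, rfl, rfl, trivial, trivial⟩)
    intro a b
    exact ((hv _ a rfl).symm _ _).trans _ _ _ (hv _ b rfl)
  acyclic := by
    rintro ⟨n, c, hT, hc, hinj, -⟩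
    obtain ⟨i, hi⟩ := Finite.exists_max (fun i => r (G.endVertex (c i)))
    have hend : ∀ d : E × Bool, d.1 ∈ T → r (G.endVertex (flipEnd d)) ≤ r (G.endVertex d) →
        G.tgt d.1 = G.endVertex d ∧ G.endVertex (flipEnd d) = G.src d.1 := by
      rintro ⟨e, b⟩ he h
      have hr' := hr e he
      cases b
      · exact ⟨rfl, rfl⟩
      · exact absurd h (not_le.2 hr')
    have h1 := hend (c i) (hT i) (by rw [hc i]; exact hi _)
    have hprev := hc (i - 1)
    rw [sub_add_cancel] at hprev
    have h2 := hend (flipEnd (c (i - 1))) (hT (i - 1)) (by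
      rw [hprev, flipEnd_flipEnd]; exact hi (i - 1))
    have h3 : (c i).1 = (c (i - 1)).1 :=
      huniq _ (hT i) _ (hT (i - 1)) (h1.1.trans (hprev.symm.trans h2.1.symm))
    have h4 : i = i - 1 := hinj h3
    have h5 : i = i + 1 := by
      have := congrArg (· + 1) h4
      simpa using this.symm
    have h6 := hc i
    rw [← h5, h1.2, ← h1.1] at h6
    have := hr _ (hT i)
    rw [h6] at this
    omega
  unique_in := huniq
  origin := horig

/-- `G.Branching v D S T`: starting from the vertex `v`, the set of edges `T` is obtained by adding
edges of `D` one at a time, each from a vertex that has been reached to one that has not,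
and `S` is the set of vertices reached in the end. -/
inductive Branching (G : EmbDigraph V E) (v : V) (D : Set E) : Set V → Set E → Prop
  | root : Branching G v D {v} ∅
  | step {S : Set V} {T : Set E} {e : E} : Branching G v D S T → e ∈ D → G.src e ∈ S →
      G.tgt e ∉ S → Branching G v D (insert (G.tgt e) S) (insert e T)

namespace Branching

variable {G : EmbDigraph V E} {v : V} {D : Set E} {S : Set V} {T : Set E}

theorem root_mem (h : G.Branching v D S T) : v ∈ S := by
  induction h with
  | root => rfl
  | step _ _ _ _ ih => exact Or.inr ih

theorem subset (h : G.Branching v D S T) : T ⊆ D := by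
  induction h with
  | root => simp
  | step _ he _ _ ih => exact Set.insert_subset he ih

theorem src_mem (h : G.Branching v D S T) {e : E} (he : e ∈ T) : G.src e ∈ S := by
  induction h with
  | root => simp at he
  | step _ _ h1 _ ih =>
    rcases he with rfl | he
    · exact Or.inr h1
    · exact Or.inr (ih he)

theorem tgt_mem (h : G.Branching v D S T) {e : E} (he : e ∈ T) : G.tgt e ∈ S := by
  induction h with
  | root => simp at he
  | step _ _ _ _ ih =>
    rcases he with rfl | he
    · exact Or.inl rfl
    · exact Or.inr (ih he)

theorem tgt_ne (h : G.Branching v D S T) {e : E} (he : e ∈ T) : G.tgt e ≠ v := by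
  induction h with
  | root => simp at he
  | step h _ _ h2 ih =>
    rcases he with rfl | he
    · intro h3; exact h2 (h3 ▸ h.root_mem)
    · exact ih he

theorem exists_tgt_eq (h : G.Branching v D S T) {x : V} (hx : x ∈ S) (hxv : x ≠ v) :
    ∃ e ∈ T, G.tgt e = x := by
  induction h with
  | root => exact absurd hx hxv
  | step _ _ _ _ ih =>
    rcases hx with rfl | hx
    · exact ⟨_, Or.inl rfl, rfl⟩
    · obtain ⟨e, he, h⟩ := ih hx
      exact ⟨e, Or.inr he, h⟩

theorem tgt_injOn (h : G.Branching v D S T) : Set.InjOn G.tgt T := by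
  induction h with
  | root => simp
  | step h _ _ h2 ih =>
    rw [Set.injOn_insert (fun h3 => h2 (h.tgt_mem h3))]
    refine ⟨ih, ?_⟩
    rintro ⟨f, hf, hfe⟩
    exact h2 (hfe ▸ h.tgt_mem hf)

/-- The order in which the vertices are reached. -/
theorem exists_rank (h : G.Branching v D S T) :
    ∃ (r : V → ℕ) (N : ℕ), (∀ x ∈ S, r x < N) ∧ ∀ e ∈ T, r (G.src e) < r (G.tgt e) := by
  classical
  induction h with
  | root => exact ⟨fun _ => 0, 1, by simp, by simp⟩
  | @step S T e h _ h1 h2 ih =>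
    obtain ⟨r, N, hN, hr⟩ := ih
    refine ⟨fun x => if x ∈ S then r x else N, N + 1, ?_, ?_⟩
    · rintro x (rfl | hx)
      · simp [h2]
      · have := hN x hx
        simp only [hx, if_true]; omega
    · rintro f (rfl | hf)
      · simp [h1, h2, hN _ h1]
      · simpa [h.src_mem hf, h.tgt_mem hf] using hr f hf

/-- A branching `S`, `U` and a branching `T` that reaches all vertices combine to a directed
spanning tree: enter the vertices of `S` by the edges of `U`, and all others by the edges of `T`. -/
theorem isSpanningTree_union {D' : Set E} {U : Set E} (hT : G.Branching v D Set.univ T)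
    (hU : G.Branching v D' S U) : G.IsSpanningTree v (U ∪ {e ∈ T | G.tgt e ∉ S}) := by
  classical
  obtain ⟨r₁, -, -, hr₁⟩ := hT.exists_rank
  obtain ⟨r₂, N, hN, hr₂⟩ := hU.exists_rank
  refine isSpanningTree_of_rank (fun x => if x ∈ S then r₂ x else N + r₁ x) ?_ ?_ ?_ ?_
  · rintro e (he | ⟨he, heS⟩)
    · simpa [hU.src_mem he, hU.tgt_mem he] using hr₂ e he
    · simp only [heS, if_false]
      split_ifs with h
      · have := hN _ h; omega
      · have := hr₁ e he; omega
  · intro x hx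
    by_cases hxS : x ∈ S
    · obtain ⟨e, he, h⟩ := hU.exists_tgt_eq hxS hx
      exact ⟨e, Or.inl he, h⟩
    · obtain ⟨e, he, rfl⟩ := hT.exists_tgt_eq (Set.mem_univ x) hx
      exact ⟨e, Or.inr ⟨he, hxS⟩, rfl⟩
  · rintro e (he | ⟨he, heS⟩) f (hf | ⟨hf, hfS⟩) hef
    · exact hU.tgt_injOn he hf hef
    · exact absurd (hef ▸ hU.tgt_mem he) hfS
    · exact absurd (hef ▸ hU.tgt_mem hf) heS
    · exact hT.tgt_injOn he hf hef
  · rintro e (he | ⟨he, -⟩)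
    · exact hU.tgt_ne he
    · exact hT.tgt_ne he

end Branching

/-- If edges of `D` leave every proper set of vertices that contains `v`, then branchings of every
size exist in `D`. -/
theorem exists_branching_ncard [Finite V] [Finite E] (G : EmbDigraph V E) (v : V) (D : Set E)
    (hD : ∀ A : Set V, v ∈ A → A ≠ Set.univ → ∃ e ∈ D, e ∈ G.leaving A) (k : ℕ)
    (hk : k < Nat.card V) :
    ∃ S T, G.Branching v D S T ∧ S.ncard = k + 1 ∧ T.ncard = k := by
  induction k with
  | zero => exact ⟨_, _, .root, by simp, by simp⟩
  | succ k ih =>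
    obtain ⟨S, T, h, hS, hT⟩ := ih (by omega)
    obtain ⟨e, he, h1, h2⟩ := hD S h.root_mem (by
      rintro rfl
      rw [Set.ncard_univ] at hS
      omega)
    refine ⟨_, _, h.step he h1 h2, ?_, ?_⟩
    · rw [Set.ncard_insert_of_notMem h2, hS]
    · rw [Set.ncard_insert_of_notMem (fun h3 => h2 (h.tgt_mem h3)), hT]

/-- The step in the proof of Edmonds' theorem on two disjoint branchings (after Lovász): a branching
whose complement still reaches every vertex from `v` can be extended by an edge that keeps this
property. The edge is taken to start outside a maximal critical set `A`, that is, one which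
a single edge outside `T` leaves; the sets left by the new edge alone then cannot exist,
because the number of edges leaving a set is submodular. -/
theorem Branching.exists_step [Finite V] {G : EmbDigraph V E} {v : V} {S : Set V}
    {T : Set E} (hG : ∀ A : Set V, v ∈ A → A ≠ Set.univ → (G.leaving A).Nontrivial)
    (h : G.Branching v Set.univ S T)
    (hT : ∀ A : Set V, v ∈ A → A ≠ Set.univ → (G.leaving A \ T).Nonempty) (hS : S ≠ Set.univ) :
    ∃ e, G.src e ∈ S ∧ G.tgt e ∉ S ∧
      ∀ A : Set V, v ∈ A → A ≠ Set.univ → (G.leaving A \ insert e T).Nonempty := by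
  -- The empty set is admitted, to cover the case without critical sets.
  obtain ⟨A, hA, hmax⟩ := (Set.toFinite {A : Set V | (A = ∅ ∨ v ∈ A) ∧ A ∪ S ≠ Set.univ ∧
    (G.leaving A \ T).Subsingleton}).exists_maximal ⟨∅, by simp [hS, leaving]⟩
  obtain ⟨hvA, hAS, hsub⟩ := hA
  obtain ⟨e, he1, he2, he3⟩ : ∃ e, G.src e ∈ S ∧ G.src e ∉ A ∧ G.tgt e ∉ A ∪ S := by
    obtain ⟨e₁, h1, e₂, h2, hne⟩ := hG (A ∪ S) (Or.inr h.root_mem) hAS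
    have hnot : ∀ e ∈ G.leaving (A ∪ S), G.src e ∈ A → e ∈ G.leaving A \ T := fun e he hs =>
      ⟨⟨hs, fun ht => he.2 (Or.inl ht)⟩, fun heT => he.2 (Or.inr (h.tgt_mem heT))⟩
    by_cases hs1 : G.src e₁ ∈ A
    · by_cases hs2 : G.src e₂ ∈ A
      · exact absurd (hsub (hnot _ h1 hs1) (hnot _ h2 hs2)) hne
      · exact ⟨e₂, h2.1.resolve_left hs2, hs2, h2.2⟩
    · exact ⟨e₁, h1.1.resolve_left hs1, hs1, h1.2⟩
  simp only [Set.mem_union, not_or] at he3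
  refine ⟨e, he1, he3.2, fun B hvB hB => ?_⟩
  by_contra hemp
  rw [Set.not_nonempty_iff_eq_empty] at hemp
  have honly : ∀ g ∈ G.leaving B, g ∉ T → g = e := by
    intro g hg hgT
    by_contra hge
    have : g ∈ G.leaving B \ insert e T := ⟨hg, by simp [hge, hgT]⟩
    simp [hemp] at this
  obtain ⟨g₀, hg₀, hg₀T⟩ := hT B hvB hB
  have heB : e ∈ G.leaving B := honly g₀ hg₀ hg₀T ▸ hg₀
  -- By maximality of `A`, two edges leave `A ∪ B`; so the edge leaving `A` also leaves `B`.
  have hnot : ¬ (G.leaving (A ∪ B) \ T).Subsingleton := by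
    intro hsubs
    have hmem : A ∪ B ∈ {A : Set V | (A = ∅ ∨ v ∈ A) ∧ A ∪ S ≠ Set.univ ∧
        (G.leaving A \ T).Subsingleton} := by
      refine ⟨Or.inr (Or.inr hvB), fun huniv => ?_, hsubs⟩
      have : G.tgt e ∈ A ∪ B ∪ S := by rw [huniv]; trivial
      rcases this with (h1 | h1) | h1
      · exact he3.1 h1
      · exact heB.2 h1
      · exact he3.2 h1
    exact he2 (hmax hmem Set.subset_union_left (Or.inr heB.1))
  have hex : ∃ g ∈ G.leaving (A ∪ B) \ T, g ≠ e := by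
    by_contra! hall
    exact hnot (fun g hg g' hg' => (hall g hg).trans (hall g' hg').symm)
  obtain ⟨g, ⟨⟨hg1, hg2⟩, hgT⟩, hge⟩ := hex
  simp only [Set.mem_union, not_or] at hg2
  have hgB : G.src g ∉ B := fun hgB => hge (honly g ⟨hgB, hg2.2⟩ hgT)
  have hgA : G.src g ∈ A := hg1.resolve_right hgB
  have hvA' : v ∈ A := by
    rcases hvA with rfl | hvA
    · exact absurd hgA (by simp)
    · exact hvA
  obtain ⟨f, ⟨hf1, hf2⟩, hfT⟩ := hT (A ∩ B) ⟨hvA', hvB⟩ (by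
    intro huniv
    have : G.tgt e ∈ A ∩ B := by rw [huniv]; trivial
    exact he3.1 this.1)
  by_cases hfA : G.tgt f ∈ A
  · have := honly f ⟨hf1.2, fun hfB => hf2 ⟨hfA, hfB⟩⟩ hfT
    exact he2 (this ▸ hf1.1)
  · have : f = g := hsub ⟨⟨hf1.1, hfA⟩, hfT⟩ ⟨⟨hgA, hg2.1⟩, hgT⟩
    exact hgB (this ▸ hf1.2)

/-- If at least two edges leave every proper set of vertices containing `v`, then there is a branching
that reaches all vertices and whose complement reaches them, too. -/
theorem exists_branching_univ [Finite V] {G : EmbDigraph V E} {v : V}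
    (hG : ∀ A : Set V, v ∈ A → A ≠ Set.univ → (G.leaving A).Nontrivial) :
    ∃ T, G.Branching v Set.univ Set.univ T ∧
      ∀ A : Set V, v ∈ A → A ≠ Set.univ → (G.leaving A \ T).Nonempty := by
  obtain ⟨S, ⟨T, h, hT⟩, hmax⟩ := (Set.toFinite {S : Set V | ∃ T, G.Branching v Set.univ S T ∧
    ∀ A : Set V, v ∈ A → A ≠ Set.univ → (G.leaving A \ T).Nonempty}).exists_maximal
    ⟨{v}, ∅, .root, fun A h1 h2 => by simpa using (hG A h1 h2).nonempty⟩
  by_cases hS : S = Set.univ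
  · subst hS; exact ⟨T, h, hT⟩
  · obtain ⟨e, h1, h2, h3⟩ := h.exists_step hG hT hS
    exact absurd (hmax ⟨_, h.step trivial h1 h2, h3⟩ (Set.subset_insert _ _) (Or.inl rfl)) h2

/-- If at least two edges leave every proper set of vertices containing `v`, then there are at least
as many directed spanning trees with origin `v` as vertices: a spanning branching `T` can be
turned step by step into one that is disjoint from it. -/
theorem card_le_ncard_tr [Finite V] [Finite E] {G : EmbDigraph V E} {v : V}
    (hG : ∀ A : Set V, v ∈ A → A ≠ Set.univ → (G.leaving A).Nontrivial) :
    Nat.card V ≤ (G.Tr v).ncard := by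
  obtain ⟨T, hT, hT'⟩ := exists_branching_univ hG
  have hD : ∀ A : Set V, v ∈ A → A ≠ Set.univ → ∃ e ∈ Tᶜ, e ∈ G.leaving A := fun A h1 h2 => by
    obtain ⟨e, he, heT⟩ := hT' A h1 h2
    exact ⟨e, heT, he⟩
  choose S U hB _ hU using fun k : Fin (Nat.card V) =>
    G.exists_branching_ncard v Tᶜ hD k.1 k.2
  let H : Fin (Nat.card V) → G.Tr v := fun k => ⟨_, hT.isSpanningTree_union (hB k)⟩
  -- The number of edges outside `T` tells the trees apart.
  have hH : ∀ k, ((H k).1 \ T).ncard = k.1 := by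
    intro k
    rw [← hU k]
    congr 1
    ext e
    have : e ∈ U k → e ∈ Tᶜ := fun he => (hB k).subset he
    simp only [H, Set.mem_sdiff, Set.mem_union, Set.mem_ofPred_eq, Set.mem_compl_iff] at this ⊢
    tauto
  have hinj : Function.Injective H := fun k l hkl => by
    apply Fin.ext
    rw [← hH k, ← hH l, hkl]
  have := Nat.card_le_card_of_injective H hinj
  rwa [Nat.card_fin] at this

theorem InGamma.leaving_nontrivial [Finite E] {G : EmbDigraph V E} (hG : G.InGamma) {v : V}
    {A : Set V} (hv : v ∈ A) (hA : A ≠ Set.univ) : (G.leaving A).Nontrivial :=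
  Set.one_lt_ncard_iff_nontrivial.1
    (hG.two_le_ncard_leaving ⟨v, hv⟩ (Set.nonempty_compl.2 hA))

/-! ### One vertex -/

/-- The inverse of an isomorphism. -/
def Iso.symm {G : EmbDigraph V E} {H : EmbDigraph V' E'} (i : Iso G H) : Iso H G where
  onV := i.onV.symm
  onE := i.onE.symm
  map_src e := by
    rw [Equiv.eq_symm_apply, ← i.map_src, Equiv.apply_symm_apply]
  map_tgt e := by
    rw [Equiv.eq_symm_apply, ← i.map_tgt, Equiv.apply_symm_apply]
  map_rot d := by
    have h := i.map_rot (i.onE.symm d.1, d.2)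
    simp only [Equiv.apply_symm_apply, Prod.mk.eta] at h
    rw [h]
    simp

theorem InGamma.nonempty_iso_Gα [Finite V] {G : EmbDigraph V E} (hG : G.InGamma)
    (hV : Nat.card V = 1) : Nonempty (Iso G Gα) := by
  have hsub : Subsingleton V := (Nat.card_eq_one_iff_unique.1 hV).1
  have hE : IsEmpty E := ⟨fun e => hG.prime.1 e (Subsingleton.elim _ _)⟩
  exact ⟨⟨Finite.equivFinOfCardEq hV, Equiv.equivOfIsEmpty _ _, fun e => hE.elim e,
    fun e => hE.elim e, fun d => hE.elim d.1⟩⟩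

/-! ### Two vertices -/

section Dipole

variable {G : EmbDigraph V E} {u v : V}

/-- If all vertices are `u` and `v`, the edges from `v` to `u` are the directed spanning trees. -/
theorem ncard_src_le_ncard_tr [Finite E] (hloop : ∀ e, G.src e ≠ G.tgt e) (hne : u ≠ v)
    (huv : ∀ x, x = v ∨ x = u) : {e | G.src e = v}.ncard ≤ (G.Tr v).ncard := by
  classical
  refine Set.ncard_le_ncard_of_injOn (fun e => {e}) ?_ ?_
  · intro e he
    have he : G.src e = v := he
    have htgt : G.tgt e = u := (huv _).resolve_left fun h => hloop e (he.trans h.symm)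
    refine isSpanningTree_of_rank (fun x => if x = v then 0 else 1) ?_ ?_ ?_ ?_
    · rintro _ rfl
      simp [he, htgt, hne]
    · intro x hx
      exact ⟨e, rfl, htgt.trans ((huv x).resolve_left hx).symm⟩
    · rintro _ rfl _ rfl _; rfl
    · rintro _ rfl; rw [htgt]; exact hne
  · intro e _ f _ h
    simpa using h

theorem card_edges_eq_two_mul [Finite E] (halt : G.Alternating)
    (hloop : ∀ e, G.src e ≠ G.tgt e) (huv : ∀ x, x = v ∨ x = u) :
    Nat.card E = 2 * {e | G.src e = v}.ncard := by
  have h1 := halt.ncard_src_eq_ncard_tgt {v}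
  simp only [Set.mem_singleton_iff] at h1
  have h2 : {e | G.src e = v} ∪ {e | G.tgt e = v} = Set.univ := by
    ext e
    simp only [Set.mem_union, Set.mem_ofPred_eq, Set.mem_univ, iff_true]
    rcases huv (G.src e) with h | h
    · exact Or.inl h
    · exact Or.inr ((huv (G.tgt e)).resolve_right fun h' => hloop e (h.trans h'.symm))
  have h3 : Disjoint {e | G.src e = v} {e | G.tgt e = v} :=
    Set.disjoint_left.2 fun e h h' => hloop e (h.trans h'.symm)
  have h4 := Set.ncard_union_eq h3
  rw [h2, Set.ncard_univ] at h4
  omega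

/-- If there are no loops and as many regions as edges, then the boundary of every region has
length two: the lengths add up to twice the number of edges, and each is at least two. -/
theorem faceNext_faceNext [Finite E] (hloop : ∀ e, G.src e ≠ G.tgt e)
    (hF : Nat.card G.Face = Nat.card E) (d : E × Bool) : G.faceNext (G.faceNext d) = d := by
  classical
  have := Fintype.ofFinite E
  have hfin : Finite G.Face := Quotient.finite _
  have := Fintype.ofFinite G.Face
  have hne : ∀ d, G.faceNext d ≠ d := by
    intro d h
    have h1 := G.endVertex_faceNext d
    rw [h] at h1
    rcases d with ⟨e, _ | _⟩
    · exact hloop e h1.symm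
    · exact hloop e h1
  have hface : ∀ d, G.faceOf (G.faceNext d) = G.faceOf d := fun d =>
    (G.faceOf_eq_iff _ _).2 (Equiv.Perm.sameCycle_apply_left.2 (Equiv.Perm.SameCycle.refl _ _))
  have hle : ∀ F : G.Face, 2 ≤ (Finset.univ.filter fun d => G.faceOf d = F).card := by
    intro F
    obtain ⟨d, rfl⟩ : ∃ d, G.faceOf d = F := Quotient.exists_rep F
    exact Finset.one_lt_card.2 ⟨G.faceNext d, by simp [hface], d, by simp, hne d⟩
  have hsum : ∑ F : G.Face, (Finset.univ.filter fun d => G.faceOf d = F).card =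
      ∑ _F : G.Face, 2 := by
    rw [← Finset.card_eq_sum_card_fiberwise (f := G.faceOf) (s := Finset.univ)
      (t := Finset.univ) (fun _ _ => by simp)]
    rw [Nat.card_eq_fintype_card, Nat.card_eq_fintype_card] at hF
    simp [hF, Fintype.card_prod]
  have heq := (Finset.sum_eq_sum_iff_of_le (fun F _ => hle F)).1 hsum.symm (G.faceOf d)
    (Finset.mem_univ _)
  obtain ⟨x, y, -, hxy⟩ := Finset.card_eq_two.1 heq.symm
  have hmem : ∀ d', G.faceOf d' = G.faceOf d → d' = x ∨ d' = y := by
    intro d' h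
    have : d' ∈ Finset.univ.filter fun d' => G.faceOf d' = G.faceOf d := by simp [h]
    rw [hxy] at this
    simpa using this
  have h0 := hmem d rfl
  have h1 := hmem (G.faceNext d) (hface d)
  have h2 := hmem (G.faceNext (G.faceNext d)) ((hface _).trans (hface d))
  have h3 := hne d
  have h4 := hne (G.faceNext d)
  grind

/-- If all regions of an alternating digraph on two vertices have length two, the rotation at one
vertex determines the digraph: the edges, numbered as they occur around the vertex `v`, occur
in the opposite order around the other vertex. -/
theorem nonempty_iso_dipole [Finite E] (halt : G.Alternating)
    (hloop : ∀ e, G.src e ≠ G.tgt e) (hne : u ≠ v) (huv : ∀ x, x = v ∨ x = u)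
    (hface : ∀ d, G.faceNext (G.faceNext d) = d) {n : ℕ} [NeZero n] (hn : Nat.card E = n)
    {e₀ : E} (he₀ : G.src e₀ = v) {H : EmbDigraph (Fin 2) (Fin n)}
    (hsrc : H.src = dipoleSrc) (htgt : H.tgt = dipoleTgt) (hrot : ∀ d, H.rot d = dipoleNext d) :
    Nonempty (Iso G H) := by
  have hinj : ∀ d d' : E × Bool, d.1 = d'.1 → G.endVertex d = v → G.endVertex d' = v →
      d = d' := by
    rintro ⟨e, b⟩ ⟨e', b'⟩ h h1 h2
    obtain rfl : e = e' := h
    cases b <;> cases b'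
    · rfl
    · exact absurd (h2.trans h1.symm) (hloop e)
    · exact absurd (h1.trans h2.symm) (hloop e)
    · rfl
  -- The ends at `v`, in their cyclic order.
  set d₀ : E × Bool := (e₀, true) with hd₀
  have hv : ∀ k, G.endVertex (G.rot^[k] d₀) = v := by
    intro k
    induction k with
    | zero => simpa [endVertex, hd₀] using he₀
    | succ k ih => rw [Function.iterate_succ_apply', endVertex_rot, ih]
  have hpar : ∀ k, (G.rot^[k] d₀).2 = decide (k % 2 = 0) := by
    intro k
    induction k with
    | zero => rfl
    | succ k ih =>
      rw [Function.iterate_succ_apply', halt.rot_snd, ih]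
      rcases Nat.mod_two_eq_zero_or_one k with h | h <;> simp [Nat.add_mod, h]
  have hper : 0 < Function.minimalPeriod G.rot d₀ :=
    Function.minimalPeriod_pos_of_mem_periodicPts
      (Function.mk_mem_periodicPts (orderOf_pos G.rot)
        (by rw [Function.IsPeriodicPt, Function.IsFixedPt, Equiv.Perm.iterate_eq_pow,
              pow_orderOf_eq_one, Equiv.Perm.one_apply]))
  have hbij : Function.Bijective
      (fun i : Fin (Function.minimalPeriod G.rot d₀) => (G.rot^[i.1] d₀).1) := by
    constructor
    · intro i j h
      exact Fin.ext (Function.iterate_injOn_Iio_minimalPeriod i.2 j.2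
        (hinj _ _ h (hv _) (hv _)))
    · intro e
      obtain ⟨d, rfl, hd⟩ : ∃ d : E × Bool, d.1 = e ∧ G.endVertex d = v := by
        rcases huv (G.src e) with h | h
        · exact ⟨(e, true), rfl, h⟩
        · exact ⟨(e, false), rfl,
            (huv (G.tgt e)).resolve_right fun h' => hloop e (h.trans h'.symm)⟩
      have hcyc : G.rot.SameCycle d₀ d := G.rot_cycle d₀ d ((hv 0).trans hd.symm)
      obtain ⟨k, rfl⟩ := hcyc.exists_nat_pow_eq
      refine ⟨⟨k % Function.minimalPeriod G.rot d₀, Nat.mod_lt _ hper⟩, ?_⟩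
      simp only [Function.iterate_mod_minimalPeriod_eq, Equiv.Perm.iterate_eq_pow]
  have hcard := Nat.card_eq_of_bijective _ hbij
  rw [Nat.card_fin, hn] at hcard
  subst hcard
  set n := Function.minimalPeriod G.rot d₀
  let q : Fin n → E × Bool := fun i => G.rot^[i.1] d₀
  let ψ : Fin n ≃ E := Equiv.ofBijective _ hbij
  have hq : ∀ i : Fin n, (q i).2 = decide (i.1 % 2 = 0) := fun i => hpar i.1
  have hnext : ∀ i, G.rot (q i) = q (i + 1) := by
    intro i
    change _ = G.rot^[(i + 1).1] d₀
    rw [Fin.val_add, Function.iterate_mod_minimalPeriod_eq]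
    have h1 : G.rot^[i.1 + (1 : Fin n).1] d₀ = G.rot^[i.1 + 1] d₀ := by
      rw [Function.iterate_add_apply, Function.iterate_add_apply]
      congr 1
      rw [Fin.val_one', Function.iterate_mod_minimalPeriod_eq]
    rw [h1, Function.iterate_succ_apply']
  have hprev : ∀ i, G.rot.symm (q i) = q (i - 1) := by
    intro i
    rw [Equiv.symm_apply_eq, hnext, sub_add_cancel]
  have hflip : ∀ d, G.rot (flipEnd d) = flipEnd (G.rot.symm d) := by
    intro d
    have h := hface (flipEnd d)
    simp only [faceNext_apply, flipEnd_flipEnd] at h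
    rw [← h, Equiv.apply_symm_apply]
  have hmk : ∀ i, (ψ i, decide (i.1 % 2 = 0)) = q i := fun i => Prod.ext rfl (hq i).symm
  have hmk' : ∀ i, (ψ i, !decide (i.1 % 2 = 0)) = flipEnd (q i) := fun i => by
    rw [← hmk]; rfl
  have hqv : ∀ i, G.endVertex (q i) = v := fun i => hv i.1
  have hqu : ∀ i, G.endVertex (flipEnd (q i)) = u := by
    intro i
    refine (huv _).resolve_left fun h => ?_
    have h1 := hinj _ _ (by rfl) h (hqv i)
    have h2 := congrArg Prod.snd h1
    simp [flipEnd] at h2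
  let w : Fin 2 ≃ V := Equiv.ofBijective (fun i => if i = 0 then v else u) (by
    constructor
    · intro i j h
      fin_cases i <;> fin_cases j <;> simp_all [hne.symm]
    · intro x
      rcases huv x with rfl | rfl
      · exact ⟨0, rfl⟩
      · exact ⟨1, rfl⟩)
  have hw0 : w 0 = v := rfl
  have hw1 : w 1 = u := rfl
  have hsrc' : ∀ i, G.src (ψ i) = w (dipoleSrc i) := by
    intro i
    unfold dipoleSrc
    split_ifs with h
    · have := hqv i
      rw [← hmk] at this
      simpa [endVertex, h, hw0, hw1] using this
    · have := hqu i
      rw [← hmk'] at this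
      simpa [endVertex, h, hw0, hw1] using this
  have htgt' : ∀ i, G.tgt (ψ i) = w (dipoleTgt i) := by
    intro i
    unfold dipoleTgt
    split_ifs with h
    · have := hqu i
      rw [← hmk'] at this
      simpa [endVertex, h, hw0, hw1] using this
    · have := hqv i
      rw [← hmk] at this
      simpa [endVertex, h, hw0, hw1] using this
  refine ⟨Iso.symm ⟨w, ψ, fun i => ?_, fun i => ?_, ?_⟩⟩
  · rw [hsrc, hsrc']
  · rw [htgt, htgt']
  · rintro ⟨i, b⟩
    rw [hrot]
    by_cases hb : b = decide (i.1 % 2 = 0)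
    · subst hb
      have h0 : (if decide (i.1 % 2 = 0) = true then dipoleSrc i else dipoleTgt i) = 0 := by
        by_cases h : i.1 % 2 = 0 <;> simp [dipoleSrc, dipoleTgt, h]
      simp only [dipoleNext, h0, if_true]
      rw [hmk, hnext]
      refine Prod.ext rfl ?_
      rw [← hnext, halt.rot_snd, hq]
    · obtain rfl : b = !decide (i.1 % 2 = 0) := by
        cases b <;> simp_all
      have h0 : (if (!decide (i.1 % 2 = 0)) = true then dipoleSrc i else dipoleTgt i) ≠ 0 := by
        by_cases h : i.1 % 2 = 0 <;> simp [dipoleSrc, dipoleTgt, h]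
      simp only [dipoleNext, h0, if_false]
      rw [hmk', hflip, hprev]
      refine Prod.ext rfl ?_
      rw [← hprev]
      simp [flipEnd, halt.rot_symm_snd, hq]

end Dipole

theorem InGamma.nonempty_iso_dipole [Finite V] [Finite E] {G : EmbDigraph V E} (hG : G.InGamma)
    (hV : Nat.card V = 2) (v : V) (hv : (G.Tr v).ncard < 4) :
    Nonempty (Iso G Gβ) ∨ Nonempty (Iso G Gγ) := by
  obtain ⟨a, b, hab, huniv⟩ := Nat.card_eq_two_iff.1 hV
  obtain ⟨u, hne, huv⟩ : ∃ u, u ≠ v ∧ ∀ x, x = v ∨ x = u := by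
    have hmem : ∀ x, x = a ∨ x = b := fun x => by
      have : x ∈ ({a, b} : Set V) := by rw [huniv]; trivial
      exact this
    rcases hmem v with rfl | rfl
    · exact ⟨b, hab.symm, hmem⟩
    · exact ⟨a, hab, fun x => (hmem x).symm⟩
  have hloop := hG.prime.1
  have htr := ncard_src_le_ncard_tr hloop hne huv
  have hE := card_edges_eq_two_mul hG.alternating hloop huv
  have hdeg : 2 ≤ {e | G.src e = v}.ncard := by
    refine (hG.two_le_ncard_leaving (A := {v}) ⟨v, rfl⟩ ⟨u, hne⟩).trans
      (Set.ncard_le_ncard fun e he => he.1)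
  obtain ⟨e₀, he₀⟩ : {e | G.src e = v}.Nonempty :=
    Set.nonempty_of_ncard_ne_zero (by omega)
  have hF : Nat.card G.Face = Nat.card E := by
    have h := hG.planar
    rw [Planar, numFaces, if_pos ⟨e₀⟩] at h
    omega
  have hface := faceNext_faceNext hloop hF
  have hcases : Nat.card E = 4 ∨ Nat.card E = 6 := by omega
  rcases hcases with h | h
  · exact Or.inl (EmbDigraph.nonempty_iso_dipole hG.alternating hloop hne huv hface h he₀
      rfl rfl fun _ => rfl)
  · exact Or.inr (EmbDigraph.nonempty_iso_dipole hG.alternating hloop hne huv hface h he₀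
      rfl rfl fun _ => rfl)

/-! ### Three vertices -/

section Triangle

variable {G : EmbDigraph V E}

/-- The edges from the `i`-th to the `j`-th vertex. -/
def edgesBetween (G : EmbDigraph V E) (w : Fin 3 ≃ V) (i j : Fin 3) : Set E :=
  {e | G.src e = w i ∧ G.tgt e = w j}

/-- A tree with origin `w 0` has one edge into `w 1` and one into `w 2`. The summands count the trees in
which both come from `w 0`, those in which the second comes from `w 1`, and those in which
the first comes from `w 2`. -/
theorem sum_mul_ncard_edgesBetween_le [Finite E] (w : Fin 3 ≃ V) :
    (G.edgesBetween w 0 1).ncard * (G.edgesBetween w 0 2).ncard +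
      (G.edgesBetween w 0 1).ncard * (G.edgesBetween w 1 2).ncard +
      (G.edgesBetween w 2 1).ncard * (G.edgesBetween w 0 2).ncard ≤ (G.Tr (w 0)).ncard := by
  have htree : ∀ (r : Fin 3 → ℕ) (i j : Fin 3) (e f : E), r i < r 1 → r j < r 2 →
      e ∈ G.edgesBetween w i 1 → f ∈ G.edgesBetween w j 2 → G.IsSpanningTree (w 0) {e, f} := by
    rintro r i j e f h1 h2 ⟨he1, he2⟩ ⟨hf1, hf2⟩
    refine isSpanningTree_of_rank (fun x => r (w.symm x)) ?_ ?_ ?_ ?_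
    · rintro _ (rfl | rfl)
      · simpa [he1, he2] using h1
      · simpa [hf1, hf2] using h2
    · intro x hx
      obtain ⟨k, rfl⟩ := w.surjective x
      fin_cases k
      · exact absurd rfl hx
      · exact ⟨e, by simp, he2⟩
      · exact ⟨f, by simp, hf2⟩
    · rintro _ (rfl | rfl) _ (rfl | rfl) h <;> simp_all
    · rintro _ (rfl | rfl)
      · rw [he2]; simp
      · rw [hf2]; simp
  have hprod : ∀ A B : Set E, (A ×ˢ B).ncard = A.ncard * B.ncard := fun A B => Set.ncard_prod
  have hd1 : Disjoint (G.edgesBetween w 0 1 ×ˢ G.edgesBetween w 0 2)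
      (G.edgesBetween w 0 1 ×ˢ G.edgesBetween w 1 2) := by
    rw [Set.disjoint_left]
    rintro ⟨e, f⟩ ⟨-, h1⟩ ⟨-, h2⟩
    exact absurd (w.injective (h1.1.symm.trans h2.1)) (by decide)
  have hd2 : Disjoint (G.edgesBetween w 0 1 ×ˢ G.edgesBetween w 0 2 ∪
      G.edgesBetween w 0 1 ×ˢ G.edgesBetween w 1 2)
      (G.edgesBetween w 2 1 ×ˢ G.edgesBetween w 0 2) := by
    rw [Set.disjoint_left]
    rintro ⟨e, f⟩ (⟨h1, -⟩ | ⟨h1, -⟩) ⟨h2, -⟩ <;>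
    exact absurd (w.injective (h1.1.symm.trans h2.1)) (by decide)
  rw [← hprod, ← hprod, ← hprod, ← Set.ncard_union_eq hd1, ← Set.ncard_union_eq hd2]
  refine Set.ncard_le_ncard_of_injOn (fun p => {p.1, p.2}) ?_ ?_
  · rintro ⟨e, f⟩ ((⟨h1, h2⟩ | ⟨h1, h2⟩) | ⟨h1, h2⟩)
    · exact htree ![0, 1, 1] 0 0 e f (by simp) (by simp) h1 h2
    · exact htree ![0, 1, 2] 0 1 e f (by simp) (by simp) h1 h2
    · exact htree ![0, 2, 1] 2 0 e f (by simp) (by simp) h1 h2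
  · have htgt : ∀ p ∈ G.edgesBetween w 0 1 ×ˢ G.edgesBetween w 0 2 ∪
        G.edgesBetween w 0 1 ×ˢ G.edgesBetween w 1 2 ∪
        G.edgesBetween w 2 1 ×ˢ G.edgesBetween w 0 2, G.tgt p.1 = w 1 ∧ G.tgt p.2 = w 2 := by
      rintro p ((h | h) | h) <;> exact ⟨h.1.2, h.2.2⟩
    rintro ⟨e, f⟩ hp ⟨e', f'⟩ hp' h
    obtain ⟨h1, h2⟩ := htgt _ hp
    obtain ⟨h3, h4⟩ := htgt _ hp'
    have hne : w 1 ≠ w 2 := by simp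
    have h : ({e, f} : Set E) = {e', f'} := h
    rcases Set.pair_eq_pair_iff.1 h with ⟨rfl, rfl⟩ | ⟨rfl, rfl⟩
    · rfl
    · exact absurd (h1.symm.trans h4) hne

/-- The only solution in natural numbers of the balance equations at the three vertices, with
out-degrees at least two and fewer than four trees, is one edge from each vertex to each other. -/
theorem ncard_edgesBetween_eq_one [Finite E] (halt : G.Alternating)
    (hloop : ∀ e, G.src e ≠ G.tgt e) (w : Fin 3 ≃ V)
    (hcut : ∀ i, 2 ≤ {e | G.src e = w i}.ncard) (hTr : (G.Tr (w 0)).ncard < 4)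
    (i j : Fin 3) (hij : i ≠ j) : (G.edgesBetween w i j).ncard = 1 := by
  have hcover : ∀ i j k : Fin 3, i ≠ j → i ≠ k → j ≠ k → ∀ l, l = i ∨ l = j ∨ l = k := by
    decide
  have hsrc : ∀ i j k : Fin 3, i ≠ j → i ≠ k → j ≠ k → {e | G.src e = w i}.ncard =
      (G.edgesBetween w i j).ncard + (G.edgesBetween w i k).ncard := by
    intro i j k hij hik hjk
    rw [← Set.ncard_union_eq]
    · congr 1
      ext e
      obtain ⟨l, hl⟩ := w.surjective (G.tgt e)
      have := hloop e
      simp only [edgesBetween, Set.mem_union, Set.mem_ofPred_eq, ← hl] at this ⊢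
      rcases hcover i j k hij hik hjk l with rfl | rfl | rfl <;> simp_all
    · rw [Set.disjoint_left]
      intro e h1 h2
      exact hjk (w.injective (h1.2.symm.trans h2.2))
  have htgt : ∀ i j k : Fin 3, i ≠ j → i ≠ k → j ≠ k → {e | G.tgt e = w i}.ncard =
      (G.edgesBetween w j i).ncard + (G.edgesBetween w k i).ncard := by
    intro i j k hij hik hjk
    rw [← Set.ncard_union_eq]
    · congr 1
      ext e
      obtain ⟨l, hl⟩ := w.surjective (G.src e)
      have := (hloop e).symm
      simp only [edgesBetween, Set.mem_union, Set.mem_ofPred_eq, ← hl] at this ⊢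
      rcases hcover i j k hij hik hjk l with rfl | rfl | rfl <;> simp_all
    · rw [Set.disjoint_left]
      intro e h1 h2
      exact hjk (w.injective (h1.1.symm.trans h2.1))
  have hbal : ∀ i, {e | G.src e = w i}.ncard = {e | G.tgt e = w i}.ncard := fun i => by
    simpa using halt.ncard_src_eq_ncard_tgt {w i}
  have htree := (G.sum_mul_ncard_edgesBetween_le w).trans (Nat.lt_succ_iff.1 hTr)
  have c0 := hcut 0
  have c1 := hcut 1
  have c2 := hcut 2
  have b0 := hbal 0
  have b1 := hbal 1
  have b2 := hbal 2
  rw [hsrc 0 1 2 (by decide) (by decide) (by decide)] at c0 b0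
  rw [hsrc 1 0 2 (by decide) (by decide) (by decide)] at c1 b1
  rw [hsrc 2 0 1 (by decide) (by decide) (by decide)] at c2 b2
  rw [htgt 0 1 2 (by decide) (by decide) (by decide)] at b0
  rw [htgt 1 0 2 (by decide) (by decide) (by decide)] at b1
  rw [htgt 2 0 1 (by decide) (by decide) (by decide)] at b2
  suffices h : (G.edgesBetween w 0 1).ncard = 1 ∧ (G.edgesBetween w 0 2).ncard = 1 ∧
      (G.edgesBetween w 1 0).ncard = 1 ∧ (G.edgesBetween w 1 2).ncard = 1 ∧
      (G.edgesBetween w 2 0).ncard = 1 ∧ (G.edgesBetween w 2 1).ncard = 1 by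
    obtain ⟨h1, h2, h3, h4, h5, h6⟩ := h
    fin_cases i <;> fin_cases j <;> first | exact absurd rfl hij | assumption
  clear hcut hTr hsrc htgt hbal hcover
  generalize (G.edgesBetween w 0 1).ncard = a at *
  generalize (G.edgesBetween w 0 2).ncard = b at *
  generalize (G.edgesBetween w 1 0).ncard = c at *
  generalize (G.edgesBetween w 1 2).ncard = d at *
  generalize (G.edgesBetween w 2 0).ncard = e at *
  generalize (G.edgesBetween w 2 1).ncard = f at *
  have ha : a ≠ 0 := by
    rintro rfl
    have : 2 * 2 ≤ f * b := Nat.mul_le_mul (by omega) (by omega)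
    omega
  have hb : b ≠ 0 := by
    rintro rfl
    have : 2 * 2 ≤ a * d := Nat.mul_le_mul (by omega) (by omega)
    omega
  have h1 : a * (b + d) ≤ 3 := by rw [mul_add]; omega
  have h2 : b * (a + f) ≤ 3 := by rw [mul_add, mul_comm b a, mul_comm b f]; omega
  have h3 : b + d ≤ 3 := (Nat.le_mul_of_pos_left _ (Nat.pos_of_ne_zero ha)).trans h1
  have h4 : a + f ≤ 3 := (Nat.le_mul_of_pos_left _ (Nat.pos_of_ne_zero hb)).trans h2
  have ha3 : a ≤ 3 := by omega
  have hb3 : b ≤ 3 := by omega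
  interval_cases a <;> interval_cases b <;> omega

/-- A permutation that is cyclic on four elements, and exchanges `{a, c}` with `{b, d}`, runs through
them either in the order `a, b, c, d` or backwards. -/
theorem _root_.Equiv.Perm.eq_or_eq_of_alternating {α : Type*} {f : Equiv.Perm α} {a b c d : α}
    (hac : a ≠ c) (hbd : b ≠ d) (hcyc : f.SameCycle a c) (ha : f a = b ∨ f a = d)
    (hb : f b = a ∨ f b = c) (hc : f c = b ∨ f c = d) (hd : f d = a ∨ f d = c)
    (hbc : b ≠ c) (hcd : c ≠ d) :
    (f a = b ∧ f b = c ∧ f c = d ∧ f d = a) ∨ (f a = d ∧ f d = c ∧ f c = b ∧ f b = a) := by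
  -- If `f` exchanged `a` and `x`, it could not carry `a` to `c`.
  have hswap : ∀ x, x ≠ c → f a = x → f x = a → False := by
    intro x hxc h1 h2
    obtain ⟨k, hk⟩ := hcyc
    have h : ∀ k : ℤ, (f ^ k) a = a ∨ (f ^ k) a = x := by
      intro k
      induction k using Int.induction_on with
      | zero => simp
      | succ k ih =>
        rw [add_comm, zpow_add, zpow_one, Equiv.Perm.mul_apply]
        rcases ih with h | h <;> rw [h]
        · exact Or.inr h1
        · exact Or.inl h2
      | pred k ih =>
        rw [sub_eq_add_neg, add_comm, zpow_add, zpow_neg_one, Equiv.Perm.mul_apply]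
        rcases ih with h | h
        · right; rw [h, Equiv.Perm.inv_eq_iff_eq, h2]
        · left; rw [h, Equiv.Perm.inv_eq_iff_eq, h1]
    rcases h k with h | h
    · exact hac (h.symm.trans hk)
    · exact hxc (h.symm.trans hk)
  have hi : ∀ x y, x ≠ y → f x ≠ f y := fun x y h => f.injective.ne h
  have h1 := hi a c hac
  have h2 := hi b d hbd
  have h3 := hswap b hbc
  have h4 := hswap d hcd.symm
  rcases ha with ha | ha <;> rcases hb with hb | hb <;> rcases hc with hc | hc <;>
    rcases hd with hd | hd <;> simp_all

/-- The inverse of the rotation on the ends of `Gδ` that agrees with the one of `Gδ` around the vertices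
`i` for which `t i` holds, and with its inverse around the others. -/
def mixedPrev (t : Fin 3 → Bool) (d : (Fin 3 × Bool) × Bool) : (Fin 3 × Bool) × Bool :=
  if t (Gδ.endVertex d) then Gδ.rot.symm d else Gδ.rot d

/-- If the rotations around the three vertices do not have the same sense, there are at most three
regions. Here `i` is the odd vertex; the regions are represented by walks along the edge that
avoids it, and along another edge in both directions. -/
theorem exists_iterate_mixedPrev (i : Fin 3) (c : Bool) (d : (Fin 3 × Bool) × Bool) :
    ∃ (j : Fin 3) (k : Fin 6),
      (fun x => mixedPrev (fun l => if l = i then c else !c) (flipEnd x))^[k.1]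
        (![((i + 1, true), c), ((i, true), c), ((i, true), !c)] j) = d := by
  revert i c d
  decide +kernel

/-- Around each vertex, an alternating digraph with the vertices and edges of `Gδ` has the rotation of
`Gδ` or its inverse. -/
theorem rot_eq_or_rot_eq (halt : G.Alternating) (w : Fin 3 ≃ V) (ψ : Fin 3 × Bool ≃ E)
    (hsrc : ∀ x, G.src (ψ x) = w (Gδ.src x)) (htgt : ∀ x, G.tgt (ψ x) = w (Gδ.tgt x))
    (i : Fin 3) :
    (∀ d, Gδ.endVertex d = i → G.rot (ψ d.1, d.2) = (ψ (Gδ.rot d).1, (Gδ.rot d).2)) ∨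
    (∀ d, Gδ.endVertex d = i →
      G.rot (ψ d.1, d.2) = (ψ (Gδ.rot.symm d).1, (Gδ.rot.symm d).2)) := by
  let Ψ : (Fin 3 × Bool) × Bool → E × Bool := fun d => (ψ d.1, d.2)
  have hΨ : Function.Injective Ψ := by
    rintro ⟨x, b⟩ ⟨y, c⟩ h
    obtain ⟨h1, h2⟩ := Prod.mk.inj h
    exact Prod.ext (ψ.injective h1) h2
  have hend : ∀ d, G.endVertex (Ψ d) = w (Gδ.endVertex d) := by
    rintro ⟨x, _ | _⟩
    · exact htgt x
    · exact hsrc x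
  have hrot : ∀ d, ∃ d', G.rot (Ψ d) = Ψ d' ∧ d'.2 = !d.2 ∧
      Gδ.endVertex d' = Gδ.endVertex d := by
    intro d
    refine ⟨(ψ.symm (G.rot (Ψ d)).1, (G.rot (Ψ d)).2), by simp [Ψ], halt.rot_snd _, ?_⟩
    apply w.injective
    rw [← hend, ← hend, ← G.endVertex_rot (Ψ d)]
    simp [Ψ]
  have hin : ∀ i d, Gδ.endVertex d = i → d.2 = false →
      d = ((i - 1, true), false) ∨ d = ((i, false), false) := by decide
  have hout : ∀ i d, Gδ.endVertex d = i → d.2 = true →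
      d = ((i - 1, false), true) ∨ d = ((i, true), true) := by decide
  have hvert : ∀ i, Gδ.endVertex ((i - 1, true), false) = i ∧
      Gδ.endVertex ((i, false), false) = i ∧ Gδ.endVertex ((i - 1, false), true) = i ∧
      Gδ.endVertex ((i, true), true) = i := by decide
  have hnext : ∀ i, Gδ.rot ((i - 1, true), false) = ((i - 1, false), true) ∧
      Gδ.rot ((i - 1, false), true) = ((i, false), false) ∧
      Gδ.rot ((i, false), false) = ((i, true), true) ∧
      Gδ.rot ((i, true), true) = ((i - 1, true), false) := by decide
  obtain ⟨v1, v2, v3, v4⟩ := hvert i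
  obtain ⟨n1, n2, n3, n4⟩ := hnext i
  have hin' : ∀ d, Gδ.endVertex d = i → d.2 = true →
      G.rot (Ψ d) = Ψ ((i - 1, true), false) ∨ G.rot (Ψ d) = Ψ ((i, false), false) := by
    intro d h1 h2
    obtain ⟨d', h, h3, h4⟩ := hrot d
    rw [h]
    exact (hin i d' (h4.trans h1) (by rw [h3, h2]; rfl)).imp (congrArg Ψ) (congrArg Ψ)
  have hout' : ∀ d, Gδ.endVertex d = i → d.2 = false →
      G.rot (Ψ d) = Ψ ((i - 1, false), true) ∨ G.rot (Ψ d) = Ψ ((i, true), true) := by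
    intro d h1 h2
    obtain ⟨d', h, h3, h4⟩ := hrot d
    rw [h]
    exact (hout i d' (h4.trans h1) (by rw [h3, h2]; rfl)).imp (congrArg Ψ) (congrArg Ψ)
  have hall : ∀ d, Gδ.endVertex d = i → (d = ((i - 1, true), false) ∨ d = ((i, false), false)) ∨
      (d = ((i - 1, false), true) ∨ d = ((i, true), true)) := by
    rintro ⟨x, _ | _⟩ h
    · exact Or.inl (hin i _ h rfl)
    · exact Or.inr (hout i _ h rfl)
  have hcyc : G.rot.SameCycle (Ψ ((i - 1, true), false)) (Ψ ((i, false), false)) :=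
    G.rot_cycle _ _ ((hend _).trans ((congrArg w (v1.trans v2.symm)).trans (hend _).symm))
  have hio : ∀ x y : Fin 3 × Bool, Ψ (x, false) ≠ Ψ (y, true) := fun x y h => by
    simpa using hΨ h
  rcases Equiv.Perm.eq_or_eq_of_alternating (hΨ.ne (by simp)) (hΨ.ne (by simp)) hcyc
    (hout' _ v1 rfl) (hin' _ v3 rfl) (hout' _ v2 rfl) (hin' _ v4 rfl)
    (hio _ _).symm (hio _ _) with ⟨h1, h2, h3, h4⟩ | ⟨h1, h2, h3, h4⟩
  · left
    intro d hd
    rcases hall d hd with (rfl | rfl) | (rfl | rfl)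
    · rw [n1]; exact h1
    · rw [n3]; exact h3
    · rw [n2]; exact h2
    · rw [n4]; exact h4
  · right
    intro d hd
    rcases hall d hd with (rfl | rfl) | (rfl | rfl)
    · rw [(Equiv.symm_apply_eq _).2 n4.symm]; exact h1
    · rw [(Equiv.symm_apply_eq _).2 n2.symm]; exact h3
    · rw [(Equiv.symm_apply_eq _).2 n1.symm]; exact h4
    · rw [(Equiv.symm_apply_eq _).2 n3.symm]; exact h2

/-- An alternating digraph with the vertices and edges of `Gδ` is `Gδ` or its mirror image, provided
that it has more than three regions. -/
theorem isoUpToReflection_Gδ (halt : G.Alternating) (w : Fin 3 ≃ V) (ψ : Fin 3 × Bool ≃ E)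
    (hsrc : ∀ x, G.src (ψ x) = w (Gδ.src x)) (htgt : ∀ x, G.tgt (ψ x) = w (Gδ.tgt x))
    (hF : 3 < Nat.card G.Face) : G.IsoUpToReflection Gδ := by
  classical
  have hor := rot_eq_or_rot_eq halt w ψ hsrc htgt
  have hrefl : ∀ d, Gδ.reflect.rot d = Gδ.rot.symm d := fun _ => rfl
  let t : Fin 3 → Bool := fun i => decide
    (∀ d, Gδ.endVertex d = i → G.rot (ψ d.1, d.2) = (ψ (Gδ.rot d).1, (Gδ.rot d).2))
  have ht : ∀ d, t (Gδ.endVertex d) = true →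
      G.rot (ψ d.1, d.2) = (ψ (Gδ.rot d).1, (Gδ.rot d).2) := fun d h =>
    of_decide_eq_true h d rfl
  have hf : ∀ d, t (Gδ.endVertex d) = false →
      G.rot (ψ d.1, d.2) = (ψ (Gδ.rot.symm d).1, (Gδ.rot.symm d).2) := fun d h =>
    (hor _).resolve_left (of_decide_eq_false h) d rfl
  have hcases : ∀ t : Fin 3 → Bool, (∀ i, t i = true) ∨ (∀ i, t i = false) ∨
      ∃ i c, t = fun l => if l = i then c else !c := by decide
  rcases hcases t with h | h | ⟨i, c, h⟩
  · exact Or.inl ⟨Iso.symm ⟨w, ψ, hsrc, htgt, fun d => ht d (h _)⟩⟩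
  · refine Or.inr ⟨Iso.symm ⟨w, ψ, hsrc, htgt, fun d => ?_⟩⟩
    rw [hrefl]
    exact hf d (h _)
  · exfalso
    let Ψ : (Fin 3 × Bool) × Bool → E × Bool := fun d => (ψ d.1, d.2)
    have hprev : ∀ d, G.rot.symm (Ψ d) = Ψ (mixedPrev t d) := by
      intro d
      rw [Equiv.symm_apply_eq]
      cases hd : t (Gδ.endVertex d)
      · rw [mixedPrev, hd, if_neg (by simp)]
        refine Eq.trans ?_ (hf _ (by rwa [endVertex_rot])).symm
        rw [Equiv.symm_apply_apply]
      · rw [mixedPrev, hd, if_pos rfl]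
        refine Eq.trans ?_ (ht _ (by rwa [endVertex_rot_symm])).symm
        rw [Equiv.apply_symm_apply]
    have hsemi : Function.Semiconj Ψ (fun x => mixedPrev t (flipEnd x)) G.faceNext := fun d =>
      (hprev _).symm
    have hsurj : Function.Surjective fun j : Fin 3 =>
        G.faceOf (Ψ (![((i + 1, true), c), ((i, true), c), ((i, true), !c)] j)) := by
      intro F
      obtain ⟨⟨e, b⟩, rfl⟩ : ∃ d, G.faceOf d = F := Quotient.exists_rep F
      obtain ⟨j, k, hjk⟩ := exists_iterate_mixedPrev i c (ψ.symm e, b)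
      refine ⟨j, (G.faceOf_eq_iff _ _).2 ⟨(k.1 : ℤ), ?_⟩⟩
      rw [zpow_natCast, ← Equiv.Perm.iterate_eq_pow, ← (hsemi.iterate_right k.1).eq, h, hjk]
      simp [Ψ]
    have := Nat.card_le_card_of_surjective _ hsurj
    rw [Nat.card_fin] at this
    omega

end Triangle

theorem InGamma.isoUpToReflection_Gδ [Finite V] [Finite E] {G : EmbDigraph V E} (hG : G.InGamma)
    (hV : Nat.card V = 3) (v : V) (hv : (G.Tr v).ncard < 4) : G.IsoUpToReflection Gδ := by
  obtain ⟨w, rfl⟩ : ∃ w : Fin 3 ≃ V, w 0 = v := by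
    let w₀ := (Finite.equivFinOfCardEq hV).symm
    exact ⟨(Equiv.swap 0 (w₀.symm v)).trans w₀, by simp⟩
  have hloop := hG.prime.1
  have hcut : ∀ i, 2 ≤ {e | G.src e = w i}.ncard := fun i =>
    (hG.two_le_ncard_leaving (A := {w i}) ⟨w i, rfl⟩ ⟨w (i + 1), by simp⟩).trans
      (Set.ncard_le_ncard fun e he => he.1)
  have hone := ncard_edgesBetween_eq_one hG.alternating hloop w hcut hv
  have hne : ∀ x, Gδ.src x ≠ Gδ.tgt x := by decide
  have hδinj : ∀ x y, Gδ.src x = Gδ.src y → Gδ.tgt x = Gδ.tgt y → x = y := by decide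
  have hδsurj : ∀ i j, i ≠ j → ∃ x, Gδ.src x = i ∧ Gδ.tgt x = j := by decide
  choose ψ hψ using fun x => Set.ncard_eq_one.1 (hone (Gδ.src x) (Gδ.tgt x) (hne x))
  have hmem : ∀ x, G.src (ψ x) = w (Gδ.src x) ∧ G.tgt (ψ x) = w (Gδ.tgt x) := fun x => by
    have : ψ x ∈ G.edgesBetween w (Gδ.src x) (Gδ.tgt x) := by rw [hψ]; rfl
    exact this
  have hbij : Function.Bijective ψ := by
    constructor
    · intro x y h
      refine hδinj x y (w.injective ?_) (w.injective ?_)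
      · rw [← (hmem x).1, ← (hmem y).1, h]
      · rw [← (hmem x).2, ← (hmem y).2, h]
    · intro e
      obtain ⟨i, hi⟩ := w.surjective (G.src e)
      obtain ⟨j, hj⟩ := w.surjective (G.tgt e)
      obtain ⟨x, rfl, rfl⟩ := hδsurj i j (by rintro rfl; exact hloop e (hi.symm.trans hj))
      have : e ∈ G.edgesBetween w (Gδ.src x) (Gδ.tgt x) := ⟨hi.symm, hj.symm⟩
      rw [hψ] at this
      exact ⟨x, this.symm⟩
  have hE : Nat.card E = 6 := by
    rw [← Nat.card_eq_of_bijective ψ hbij]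
    simp
  have hF := hG.planar
  rw [Planar, numFaces, if_pos ⟨ψ (0, true)⟩] at hF
  exact EmbDigraph.isoUpToReflection_Gδ hG.alternating w (Equiv.ofBijective ψ hbij)
    (fun x => (hmem x).1) (fun x => (hmem x).2) (by omega)

end EmbDigraph

theorem mainTheorem4 {V : Type*} {E : Type*} [Finite V] [Finite E] (G : EmbDigraph V E)
    (hG : G.InGamma) (v : V) (hv : (G.Tr v).ncard < 4) :
    G.IsoUpToReflection EmbDigraph.Gα ∨ G.IsoUpToReflection EmbDigraph.Gβ ∨
      G.IsoUpToReflection EmbDigraph.Gγ ∨ G.IsoUpToReflection EmbDigraph.Gδ := by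
  have hle := EmbDigraph.card_le_ncard_tr (G := G) (v := v)
    fun A h1 h2 => hG.leaving_nontrivial h1 h2
  have hpos : 0 < Nat.card V := Nat.card_pos_iff.2 ⟨⟨v⟩, inferInstance⟩
  have hcases : Nat.card V = 1 ∨ Nat.card V = 2 ∨ Nat.card V = 3 := by omega
  rcases hcases with h | h | h
  · exact Or.inl (Or.inl (hG.nonempty_iso_Gα h))
  · rcases hG.nonempty_iso_dipole h v hv with h | h
    · exact Or.inr (Or.inl (Or.inl h))
    · exact Or.inr (Or.inr (Or.inl (Or.inl h)))
  · exact Or.inr (Or.inr (Or.inr (hG.isoUpToReflection_Gδ h v hv)))
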